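/- A \emph{stochastic game} has a finite set $S$ of states, each owned by Maximizer or by Minimizer, an initial state, a finite set $A$ of actions, a non-empty set $\mathrm{Av}(s)\subseteq A$ of available actions for each state $s$, and a transition function $\delta$ that assigns to $(s,a)$ a probability distribution $\delta(s,a,\cdot)$ on $S$. A strategy of a player assigns to each state $s$ of that player a probability distribution on $\mathrm{Av}(s)$. A pair $(\sigma,\tau)$ of strategies of Maximizer and Minimizer induces a Markov chain on $S$; let $\mathbb P_s^{\sigma,\tau}$ be its law on infinite paths when started in $s$. For a goal set $\mathsf{Goal}\subseteq S$ let $\mathrm{val}(s)=\sup_\sigma\inf_\tau\mathbb P_s^{\sigma,\tau}(\exists i:\ s_i\in\mathsf{Goal})$. Let $\#(s,a,t)\in\mathbb N$ be the number of times that the successor $t$ was observed for $(s,a)$, let $\#(s,a)=\sum_t\#(s,a,t)$, let $\delta_{\mathbb T}\in(0,1]$ be an error tolerance, and put $$\widehat\delta(s,a,t)=\max\Bigl(0,\ \frac{\#(s,a,t)}{\#(s,a)}-\sqrt{\frac{\ln\delta_{\mathbb T}}{-2\,\#(s,a)}}\Bigr),$$ where $\widehat\delta(s,a,t)=0$ if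 $\#(s,a)=0$. For functions $\mathrm{lb},\mathrm{ub}:S\to\mathbb R$ define $$\widehat{\mathrm{lb}}(s,a)=\sum_{t:\#(s,a,t)>0}\widehat\delta(s,a,t)\,\mathrm{lb}(t),\qquad \widehat{\mathrm{ub}}(s,a)=\sum_{t:\#(s,a,t)>0}\widehat\delta(s,a,t)\,\mathrm{ub}(t)+\Bigl(1-\sum_{t:\#(s,a,t)>0}\widehat\delta(s,a,t)\Bigr).$$ For a set $X\subseteq S$, the procedure $\mathsf{UPDATE}(X)$ replaces, for each $f\in\{\mathrm{lb},\mathrm{ub}\}$ and each $s\in X\setminus\mathsf{Goal}$, the entry $f(s)$ by $\max_{a\in\mathrm{Av}(s)}\widehat f(s,a)$ if $s$ belongs to Maximizer and by $\min_{a\in\mathrm{Av}(s)}\widehat f(s,a)$ if $s$ belongs to Minimizer; all other entries stay unchanged. \textbf{Lemma.} Suppose that $\mathrm{lb}(s)\le\mathrm{val}(s)\le\mathrm{ub}(s)$ for all $s\in S$, and that $\widehat\delta(s,a,t)\le\delta(s,a,t)$ for all $s\in S$, $a\in\mathrm{Av}(s)$, $t\in S$. Let $\mathrm{lb}'$ and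 $\mathrm{ub}'$ be the functions obtained by one application of $\mathsf{UPDATE}(X)$ for some $X\subseteq S$. Then $\mathrm{lb}'(s)\le\mathrm{val}(s)\le\mathrm{ub}'(s)$ for all $s\in S$. This holds both when all states are updated simultaneously from the old functions and when they are updated in place, one after the other, in any order. -/

import Mathlib

open MeasureTheory ProbabilityTheory

/-- The two players of a turn-based stochastic game. -/
inductive Player
  | maximizer
  | minimizer

/-- A turn-based two-player stochastic game with finite state set `S` and finite action set `A`
(finiteness is imposed through `Fintype` where the game is used). The function `player` encodes
the partition of the states into those of Maximizer and those of Minimizer; `Av_nonempty` says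
that the game is non-blocking. -/
structure StochasticGame (S A : Type*) where
  player : S → Player
  init : S
  Av : S → Finset A
  Av_nonempty : ∀ s, (Av s).Nonempty
  trans : S → A → PMF S

namespace StochasticGame

variable {S A : Type*}

/-- The transition probability `δ(s,a,t)` as a real number. -/
noncomputable def prob (G : StochasticGame S A) (s : S) (a : A) (t : S) : ℝ :=
  (G.trans s a t).toReal

/-- Memoryless randomized strategies of player `p`: every state of `p` is mapped to a probability
distribution on the actions available there. -/
def Strategy (G : StochasticGame S A) (p : Player) : Type _ :=
  {σ : {s : S // G.player s = p} → PMF A // ∀ s, ∀ a ∈ (σ s).support, a ∈ G.Av s}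

/-- The distribution of the action played in state `s` under the strategy pair `(σ, τ)`. -/
noncomputable def choice (G : StochasticGame S A) (σ : G.Strategy .maximizer)
    (τ : G.Strategy .minimizer) (s : S) : PMF A :=
  match h : G.player s with
  | .maximizer => σ.1 ⟨s, h⟩
  | .minimizer => τ.1 ⟨s, h⟩

/-- The transition function `s ↦ (t ↦ ∑ a, choice(s)(a) * δ(s,a,t))` of the Markov chain induced
by the strategy pair `(σ, τ)`. -/
noncomputable def step (G : StochasticGame S A) (σ : G.Strategy .maximizer)
    (τ : G.Strategy .minimizer) (s : S) : PMF S :=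
  (G.choice σ τ s).bind (G.trans s)

section Measure

variable [Fintype S] [MeasurableSpace S] [DiscreteMeasurableSpace S]

/-- One step of the induced Markov chain, as a kernel from histories `s₀ … sₙ` to the next state;
it depends on the last state of the history only. -/
noncomputable def stepKernel (G : StochasticGame S A) (σ : G.Strategy .maximizer)
    (τ : G.Strategy .minimizer) (n : ℕ) : Kernel (Finset.Iic n → S) S :=
  (Kernel.ofFunOfCountable fun s => (G.step σ τ s).toMeasure).comap
    (fun h => h ⟨n, Finset.mem_Iic.2 le_rfl⟩) (measurable_pi_apply _)

instance (G : StochasticGame S A) (σ : G.Strategy .maximizer) (τ : G.Strategy .minimizer)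
    (n : ℕ) : IsMarkovKernel (G.stepKernel σ τ n) where
  isProbabilityMeasure h := by
    change IsProbabilityMeasure
      (G.step σ τ (h ⟨n, Finset.mem_Iic.2 le_rfl⟩)).toMeasure
    infer_instance

/-- The law on infinite paths of the Markov chain induced by `(σ, τ)` and started in `s`. -/
noncomputable def pathMeasure (G : StochasticGame S A) (σ : G.Strategy .maximizer)
    (τ : G.Strategy .minimizer) (s : S) : Measure (ℕ → S) :=
  Kernel.trajMeasure (X := fun _ => S) (Measure.dirac s) (G.stepKernel σ τ)

/-- The probability of eventually reaching `Goal` from `s` under `(σ, τ)`. -/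
noncomputable def reachProb (G : StochasticGame S A) (Goal : Set S) (σ : G.Strategy .maximizer)
    (τ : G.Strategy .minimizer) (s : S) : ℝ :=
  (G.pathMeasure σ τ s).real {ω | ∃ i, ω i ∈ Goal}

/-- The value of the reachability game at `s`. -/
noncomputable def val (G : StochasticGame S A) (Goal : Set S) (s : S) : ℝ :=
  ⨆ σ : G.Strategy .maximizer, ⨅ τ : G.Strategy .minimizer, G.reachProb Goal σ τ s

end Measure

/-- `max` over the available actions in Maximizer's states, `min` in Minimizer's states. -/
noncomputable def opt (G : StochasticGame S A) (s : S) (q : A → ℝ) : ℝ :=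
  match G.player s with
  | .maximizer => (G.Av s).sup' (G.Av_nonempty s) q
  | .minimizer => (G.Av s).inf' (G.Av_nonempty s) q

/-- Simultaneous update of all states of `X \ Goal`: every new entry is computed from the old
function `f`. Here `fhat f s a` is the modified state-action value computed from `f`. -/
noncomputable def updateSim (G : StochasticGame S A) (Goal : Set S)
    (fhat : (S → ℝ) → S → A → ℝ) (X : Set S) (f : S → ℝ) : S → ℝ :=
  open Classical in fun s => if s ∈ X \ Goal then G.opt s (fhat f s) else f s

/-- In-place update: the states of the list `l` are processed one after the other, and each new
entry is immediately visible to the later ones. -/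
noncomputable def updateSeq (G : StochasticGame S A)
    (fhat : (S → ℝ) → S → A → ℝ) (l : List S) (f : S → ℝ) : S → ℝ :=
  open Classical in l.foldl (fun g s => Function.update g s (G.opt s (fhat g s))) f

end StochasticGame

section Estimates

variable {S A : Type*} [Fintype S]

/-- The number of times the state-action pair `(s,a)` was played. -/
def pairCount (count : S → A → S → ℕ) (s : S) (a : A) : ℕ := ∑ t, count s a t

/-- The confidence width `√(ln δT / (-2 #(s,a)))`. -/
noncomputable def confWidth (count : S → A → S → ℕ) (δT : ℝ) (s : S) (a : A) : ℝ :=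
  Real.sqrt (Real.log δT / (-2 * (pairCount count s a : ℝ)))

/-- The lower estimate `max (0, #(s,a,t) / #(s,a) - c)` of a transition probability. If `(s,a)` was
never played, division by zero makes this `0`. -/
noncomputable def lowerEst (count : S → A → S → ℕ) (δT : ℝ) (s : S) (a : A) (t : S) : ℝ :=
  max 0 ((count s a t : ℝ) / (pairCount count s a : ℝ) - confWidth count δT s a)

/-- The modified lower bound of a state-action pair: unaccounted mass gets value `0`. -/
noncomputable def lbHat (count : S → A → S → ℕ) (δT : ℝ) (lb : S → ℝ) (s : S) (a : A) : ℝ :=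
  ∑ t with 0 < count s a t, lowerEst count δT s a t * lb t

/-- The modified upper bound of a state-action pair: unaccounted mass gets value `1`. -/
noncomputable def ubHat (count : S → A → S → ℕ) (δT : ℝ) (ub : S → ℝ) (s : S) (a : A) : ℝ :=
  (∑ t with 0 < count s a t, lowerEst count δT s a t * ub t) +
    (1 - ∑ t with 0 < count s a t, lowerEst count δT s a t)

end Estimates

/-!
The updates are sound because `val` solves the Bellman equation outside of `Goal` (`bellman_val`):
replacing `δ` by the lower estimates `lowerEst ≤ δ`, with the missing mass valued `0` for the lower
and `1` for the upper bound, only moves the right-hand side of that equation in the safe direction,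
since `0 ≤ val ≤ 1`. Every single update therefore preserves the bound, and the in-place version
follows by induction on the list.

Strategies are memoryless, so the Bellman equation is not a matter of concatenating strategies.
It comes from comparing `val` with (sub-)solutions of the equation.

* A non-negative supersolution `v` bounds `val` from above (`val_le_of_bellman_le`): Minimizer plays
  an action that is optimal with respect to `v`, and `v` dominates the probabilities of reaching
  `Goal` within `n` steps by induction on `n`.
* Playing greedily with respect to a solution of the equation need not be optimal for Maximizer, who
  may move around forever without reaching `Goal`. Discounting by `c < 1` repairs this: a subsolution
  of the discounted equation is a lower bound of `val` (`le_val_of_le_bellman`).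
* The discounted operators have fixed points, which lie between `0` and `val`. By compactness they
  accumulate, as `c → 1`, at a fixed point of the undiscounted operator that is at most `val`, and
  at least `val` because it is a supersolution.

Both comparisons use the path measure only through the one-step equation for the probabilities of
reaching `Goal` within `n` steps (`reachWithin_succ`) and its limit (`reachProb_eq_stepMean`).
-/

namespace StochasticGame

variable {S A : Type*}

/-! ### One-step equations for reachability probabilities -/

lemma sum_toReal_eq_one {α : Type*} [Fintype α] (p : PMF α) : ∑ a, (p a).toReal = 1 := by
  rw [← ENNReal.toReal_sum fun a _ => p.apply_ne_top a, ← tsum_fintype (L := .unconditional _),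
    p.tsum_coe, ENNReal.toReal_one]

/-- The set of paths that stay outside `Goal` up to time `n`. -/
def avoid (Goal : Set S) (n : ℕ) : Set (ℕ → S) := {ω | ∀ i ≤ n, ω i ∉ Goal}

lemma measurableSet_avoid [MeasurableSpace S] [DiscreteMeasurableSpace S] (Goal : Set S)
    (n : ℕ) : MeasurableSet (avoid Goal n) := by
  have : avoid Goal n = ⋂ i ∈ Finset.Iic n, (fun ω : ℕ → S => ω i) ⁻¹' Goalᶜ := by
    ext ω; simp [avoid]
  rw [this]
  exact Finset.measurableSet_biInter _ fun i _ => measurable_pi_apply i (MeasurableSet.of_discrete)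

section PathMeasure

variable [Fintype S] [MeasurableSpace S] [DiscreteMeasurableSpace S]

instance (G : StochasticGame S A) (σ : G.Strategy .maximizer) (τ : G.Strategy .minimizer)
    (s : S) : IsProbabilityMeasure (G.pathMeasure σ τ s) := by
  unfold pathMeasure
  infer_instance

lemma pathMeasure_map_zero (G : StochasticGame S A) (σ : G.Strategy .maximizer)
    (τ : G.Strategy .minimizer) (s : S) :
    (G.pathMeasure σ τ s).map (fun ω => ω 0) = Measure.dirac s := by
  have h : (fun ω : ℕ → S => ω 0) =
      (fun x : Finset.Iic 0 → S => x ⟨0, by simp⟩) ∘ (Preorder.frestrictLe (π := fun _ => S) 0) := rfl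
  have h0 := Measure.map_dirac'
    (MeasurableEquiv.piUnique fun _ : Finset.Iic 0 => S).symm.measurable s
  rw [pathMeasure, Kernel.trajMeasure, h0, Measure.dirac_bind (Kernel.measurable _), h,
    ← Measure.map_map (by fun_prop) (by fun_prop),
    Kernel.traj_map_frestrictLe_apply, Kernel.partialTraj_self, Kernel.id_apply,
    Measure.map_dirac' (by fun_prop)]
  rfl

open scoped ENNReal in
/-- The Markov property at time `n`, tested against products `F(ω₀, …, ωₙ) * g(ωₙ₊₁)`. -/
lemma lintegral_pathMeasure_succ (G : StochasticGame S A) (σ : G.Strategy .maximizer)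
    (τ : G.Strategy .minimizer) (s : S) (n : ℕ) {F : (Finset.Iic n → S) → ℝ≥0∞}
    (hF : Measurable F) (g : S → ℝ≥0∞) :
    ∫⁻ ω, F (Preorder.frestrictLe (π := fun _ => S) n ω) * g (ω (n + 1)) ∂G.pathMeasure σ τ s =
      ∫⁻ ω, F (Preorder.frestrictLe (π := fun _ => S) n ω) * (∑ u, G.step σ τ (ω n) u * g u)
        ∂G.pathMeasure σ τ s := by
  have hg : Measurable g := Measurable.of_discrete
  have key := Kernel.map_frestrictLe_trajMeasure_compProd_eq_map_trajMeasure (X := fun _ => S)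
    (μ₀ := Measure.dirac s) (κ := G.stepKernel σ τ) (a := n)
  have hH : Measurable fun p : (Finset.Iic n → S) × S => F p.1 * g p.2 := by fun_prop
  have h1 : ∫⁻ ω, F (Preorder.frestrictLe (π := fun _ => S) n ω) * g (ω (n + 1))
      ∂G.pathMeasure σ τ s = ∫⁻ p, F p.1 * g p.2 ∂((G.pathMeasure σ τ s).map
        (fun x => (Preorder.frestrictLe (π := fun _ => S) n x, x (n + 1)))) := by
    rw [lintegral_map hH (by fun_prop)]
  rw [h1, pathMeasure, ← key, Measure.lintegral_compProd hH, lintegral_map _ (by fun_prop)]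
  · refine lintegral_congr fun ω => ?_
    dsimp only
    rw [lintegral_const_mul _ hg]
    congr 1
    rw [lintegral_fintype]
    refine Finset.sum_congr rfl fun u _ => ?_
    rw [mul_comm]
    congr 1
    change (G.step σ τ (ω n)).toMeasure {u} = _
    rw [PMF.toMeasure_apply_singleton _ _ (MeasurableSet.singleton u)]
  · exact hH.lintegral_kernel_prod_right'

open scoped ENNReal in
open Classical in
/-- The transition operator of the induced chain killed on entering `Goal`: the mean of `g` over the
successors of `s` that lie outside of `Goal`. Whether `s` itself lies in `Goal` plays no role. -/
noncomputable def killedStep (G : StochasticGame S A) (Goal : Set S) (σ : G.Strategy .maximizer)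
    (τ : G.Strategy .minimizer) (g : S → ℝ≥0∞) (s : S) : ℝ≥0∞ :=
  ∑ u, G.step σ τ s u * if u ∈ Goal then 0 else g u

open scoped ENNReal in
open Classical in
/-- The chain killed on entering `Goal` has the transition operator `killedStep`. As the iterates of
this operator commute with it, a first step can be split off from `avoid Goal (n + 1)` although
`lintegral_pathMeasure_succ` only speaks of the last one. -/
lemma lintegral_indicator_avoid (G : StochasticGame S A) (Goal : Set S)
    (σ : G.Strategy .maximizer) (τ : G.Strategy .minimizer) (s : S) (n : ℕ) (g : S → ℝ≥0∞) :
    ∫⁻ ω, (avoid Goal n).indicator (fun ω => g (ω n)) ω ∂G.pathMeasure σ τ s =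
      if s ∈ Goal then 0 else (G.killedStep Goal σ τ)^[n] g s := by
  induction n generalizing g with
  | zero =>
    have hk : Measurable fun u => if u ∈ Goal then 0 else g u := Measurable.of_discrete
    have : ∀ ω : ℕ → S, (avoid Goal 0).indicator (fun ω => g (ω 0)) ω =
        (fun u => if u ∈ Goal then 0 else g u) (ω 0) := by
      intro ω
      by_cases h : ω 0 ∈ Goal <;> simp [avoid, Set.indicator, h]
    simp_rw [this]
    rw [← lintegral_map hk (measurable_pi_apply 0), pathMeasure_map_zero, lintegral_dirac' _ hk]
    simp
  | succ n ih =>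
    -- `B` is the event `avoid Goal n` as a set of histories `ω₀, …, ωₙ`.
    let B : Set (Finset.Iic n → S) := {h | ∀ i, h i ∉ Goal}
    have hB : MeasurableSet B := by
      have : B = ⋂ i, (fun h : Finset.Iic n → S => h i) ⁻¹' Goalᶜ := by
        ext; simp [B]
      rw [this]
      exact MeasurableSet.iInter fun i => measurable_pi_apply i MeasurableSet.of_discrete
    have hBa : ∀ ω : ℕ → S, Preorder.frestrictLe (π := fun _ => S) n ω ∈ B ↔ ω ∈ avoid Goal n := by
      intro ω; simp [B, avoid]
    have h1 : ∀ ω : ℕ → S, (avoid Goal (n + 1)).indicator (fun ω => g (ω (n + 1))) ω =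
        B.indicator 1 (Preorder.frestrictLe (π := fun _ => S) n ω) *
          (fun u => if u ∈ Goal then 0 else g u) (ω (n + 1)) := by
      intro ω
      have hs : ω ∈ avoid Goal (n + 1) ↔ ω ∈ avoid Goal n ∧ ω (n + 1) ∉ Goal := by
        simp only [avoid, Set.mem_ofPred_eq, Nat.le_succ_iff]
        constructor
        · exact fun h => ⟨fun i hi => h i (.inl hi), h _ (.inr rfl)⟩
        · rintro ⟨h, h'⟩ i (hi | rfl)
          exacts [h i hi, h']
      simp only [Set.indicator, hBa, hs]
      by_cases ha : ω ∈ avoid Goal n <;> by_cases hb : ω (n + 1) ∈ Goal <;> simp [ha, hb]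
    have h2 : ∀ ω : ℕ → S, B.indicator 1 (Preorder.frestrictLe (π := fun _ => S) n ω) *
        (∑ u, G.step σ τ (ω n) u * if u ∈ Goal then 0 else g u) =
        (avoid Goal n).indicator (fun ω => G.killedStep Goal σ τ g (ω n)) ω := by
      intro ω
      simp only [Set.indicator, hBa]
      by_cases ha : ω ∈ avoid Goal n <;> simp [ha, killedStep]
    rw [lintegral_congr h1]
    rw [lintegral_pathMeasure_succ G σ τ s n (measurable_one.indicator hB)
      fun u => if u ∈ Goal then 0 else g u]
    simp_rw [h2]
    rw [ih, Function.iterate_succ_apply]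

open Classical in
lemma pathMeasure_avoid (G : StochasticGame S A) (Goal : Set S)
    (σ : G.Strategy .maximizer) (τ : G.Strategy .minimizer) (n : ℕ) (s : S) :
    G.pathMeasure σ τ s (avoid Goal n) =
      if s ∈ Goal then 0 else (G.killedStep Goal σ τ)^[n] 1 s := by
  rw [← lintegral_indicator_avoid, ← lintegral_indicator_one (measurableSet_avoid Goal n)]
  rfl

open Classical in
lemma pathMeasure_avoid_succ (G : StochasticGame S A) (Goal : Set S)
    (σ : G.Strategy .maximizer) (τ : G.Strategy .minimizer) (s : S) (n : ℕ) :
    G.pathMeasure σ τ s (avoid Goal (n + 1)) =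
      if s ∈ Goal then 0 else ∑ u, G.step σ τ s u * G.pathMeasure σ τ u (avoid Goal n) := by
  simp_rw [pathMeasure_avoid, Function.iterate_succ_apply']
  rfl

/-- The probability of reaching `Goal` within `n` steps. -/
noncomputable def reachWithin (G : StochasticGame S A) (Goal : Set S) (σ : G.Strategy .maximizer)
    (τ : G.Strategy .minimizer) (n : ℕ) (s : S) : ℝ :=
  (G.pathMeasure σ τ s).real (avoid Goal n)ᶜ

lemma reachWithin_eq (G : StochasticGame S A) (Goal : Set S) (σ : G.Strategy .maximizer)
    (τ : G.Strategy .minimizer) (n : ℕ) (s : S) :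
    G.reachWithin Goal σ τ n s = 1 - (G.pathMeasure σ τ s).real (avoid Goal n) :=
  probReal_compl_eq_one_sub (measurableSet_avoid Goal n)

/-- The expectation of `f` after one step of the induced chain. -/
noncomputable def stepMean (G : StochasticGame S A) (σ : G.Strategy .maximizer)
    (τ : G.Strategy .minimizer) (f : S → ℝ) (s : S) : ℝ :=
  ∑ u, (G.step σ τ s u).toReal * f u

lemma reachWithin_zero (G : StochasticGame S A) (Goal : Set S) (σ : G.Strategy .maximizer)
    (τ : G.Strategy .minimizer) {s : S} (hs : s ∉ Goal) : G.reachWithin Goal σ τ 0 s = 0 := by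
  simp [reachWithin_eq, Measure.real, pathMeasure_avoid, hs]

lemma reachWithin_succ (G : StochasticGame S A) (Goal : Set S) (σ : G.Strategy .maximizer)
    (τ : G.Strategy .minimizer) (n : ℕ) {s : S} (hs : s ∉ Goal) :
    G.reachWithin Goal σ τ (n + 1) s = G.stepMean σ τ (G.reachWithin Goal σ τ n) s := by
  simp only [stepMean, reachWithin_eq, mul_sub, Finset.sum_sub_distrib, mul_one,
    sum_toReal_eq_one]
  congr 1
  rw [Measure.real, pathMeasure_avoid_succ, if_neg hs, ENNReal.toReal_sum]
  · simp [ENNReal.toReal_mul, Measure.real]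
  · exact fun u _ => ENNReal.mul_ne_top (PMF.apply_ne_top _ _) (measure_ne_top _ _)

lemma tendsto_reachWithin (G : StochasticGame S A) (Goal : Set S) (σ : G.Strategy .maximizer)
    (τ : G.Strategy .minimizer) (s : S) :
    Filter.Tendsto (fun n => G.reachWithin Goal σ τ n s) Filter.atTop
      (nhds (G.reachProb Goal σ τ s)) := by
  have hU : {ω : ℕ → S | ∃ i, ω i ∈ Goal} = ⋃ n, (avoid Goal n)ᶜ := by
    ext ω
    simp only [avoid, Set.mem_ofPred_eq, Set.mem_iUnion, Set.mem_compl_iff, not_forall, not_not]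
    exact ⟨fun ⟨i, hi⟩ => ⟨i, i, le_rfl, hi⟩, fun ⟨_, i, _, hi⟩ => ⟨i, hi⟩⟩
  have hm : Monotone fun n => (avoid Goal n)ᶜ := fun m n hmn =>
    Set.compl_subset_compl.2 fun ω hω i hi => hω i (hi.trans hmn)
  rw [reachProb, hU]
  exact (ENNReal.tendsto_toReal (measure_ne_top _ _)).comp (tendsto_measure_iUnion_atTop hm)

lemma reachProb_eq_stepMean (G : StochasticGame S A) (Goal : Set S) (σ : G.Strategy .maximizer)
    (τ : G.Strategy .minimizer) {s : S} (hs : s ∉ Goal) :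
    G.reachProb Goal σ τ s = G.stepMean σ τ (G.reachProb Goal σ τ) s := by
  refine tendsto_nhds_unique
    ((tendsto_reachWithin G Goal σ τ s).comp (Filter.tendsto_add_atTop_nat 1)) ?_
  simp only [Function.comp_def, G.reachWithin_succ Goal σ τ _ hs, stepMean]
  exact tendsto_finsetSum _ fun u _ => (tendsto_reachWithin G Goal σ τ u).const_mul _

lemma reachWithin_of_mem (G : StochasticGame S A) {Goal : Set S} (σ : G.Strategy .maximizer)
    (τ : G.Strategy .minimizer) (n : ℕ) {s : S} (hs : s ∈ Goal) :
    G.reachWithin Goal σ τ n s = 1 := by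
  simp [reachWithin_eq, Measure.real, pathMeasure_avoid, hs]

lemma reachProb_of_mem (G : StochasticGame S A) {Goal : Set S} (σ : G.Strategy .maximizer)
    (τ : G.Strategy .minimizer) {s : S} (hs : s ∈ Goal) : G.reachProb Goal σ τ s = 1 :=
  tendsto_nhds_unique (tendsto_reachWithin G Goal σ τ s)
    (by simp [G.reachWithin_of_mem σ τ _ hs])

end PathMeasure

/-! ### The Bellman operator -/

lemma opt_le_opt_add (G : StochasticGame S A) (s : S) {q q' : A → ℝ} {c : ℝ}
    (h : ∀ a ∈ G.Av s, q a ≤ q' a + c) : G.opt s q ≤ G.opt s q' + c := by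
  unfold opt
  split
  · refine Finset.sup'_le _ _ fun a ha => (h a ha).trans ?_
    gcongr
    exact Finset.le_sup' q' ha
  · obtain ⟨a, ha, hq⟩ := Finset.exists_mem_eq_inf' (G.Av_nonempty s) q'
    rw [hq]
    exact (Finset.inf'_le q ha).trans (h a ha)

lemma opt_mono (G : StochasticGame S A) (s : S) {q q' : A → ℝ}
    (h : ∀ a ∈ G.Av s, q a ≤ q' a) : G.opt s q ≤ G.opt s q' := by
  simpa using G.opt_le_opt_add s (c := 0) (by simpa using h)

lemma exists_opt_eq (G : StochasticGame S A) (s : S) (q : A → ℝ) :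
    ∃ a ∈ G.Av s, G.opt s q = q a := by
  unfold opt
  split
  · exact Finset.exists_mem_eq_sup' (G.Av_nonempty s) q
  · exact Finset.exists_mem_eq_inf' (G.Av_nonempty s) q

lemma le_opt_of_maximizer (G : StochasticGame S A) {s : S} (hs : G.player s = .maximizer)
    (q : A → ℝ) {a : A} (ha : a ∈ G.Av s) : q a ≤ G.opt s q := by
  unfold opt
  split
  · exact Finset.le_sup' q ha
  · simp_all

lemma opt_le_of_minimizer (G : StochasticGame S A) {s : S} (hs : G.player s = .minimizer)
    (q : A → ℝ) {a : A} (ha : a ∈ G.Av s) : G.opt s q ≤ q a := by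
  unfold opt
  split
  · simp_all
  · exact Finset.inf'_le q ha

lemma prob_nonneg (G : StochasticGame S A) (s : S) (a : A) (t : S) : 0 ≤ G.prob s a t :=
  ENNReal.toReal_nonneg

section Bellman

variable [Fintype S]

/-- The expectation of `f` at the successor of the state-action pair `(s, a)`. -/
noncomputable def actionMean (G : StochasticGame S A) (f : S → ℝ) (s : S) (a : A) : ℝ :=
  ∑ t, G.prob s a t * f t

lemma sum_prob (G : StochasticGame S A) (s : S) (a : A) : ∑ t, G.prob s a t = 1 :=
  sum_toReal_eq_one _

lemma actionMean_le_add (G : StochasticGame S A) {f g : S → ℝ} {c : ℝ}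
    (h : ∀ t, f t ≤ g t + c) (s : S) (a : A) :
    G.actionMean f s a ≤ G.actionMean g s a + c := by
  calc G.actionMean f s a ≤ ∑ t, G.prob s a t * (g t + c) :=
        Finset.sum_le_sum fun t _ => mul_le_mul_of_nonneg_left (h t) (G.prob_nonneg s a t)
    _ = _ := by
        simp only [mul_add, Finset.sum_add_distrib, ← Finset.sum_mul, sum_prob, one_mul]
        rfl

lemma actionMean_const (G : StochasticGame S A) (c : ℝ) (s : S) (a : A) :
    G.actionMean (fun _ => c) s a = c := by
  simp [actionMean, ← Finset.sum_mul, sum_prob]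

open Classical in
/-- The Bellman operator of the reachability game, discounted by `c`. The entries in `Goal` are `1`
without discount; `c = 1` gives the ordinary operator. -/
noncomputable def bellman (G : StochasticGame S A) (Goal : Set S) (c : ℝ) (f : S → ℝ) (s : S) : ℝ :=
  if s ∈ Goal then 1 else c * G.opt s (G.actionMean f s)

lemma bellman_le_add (G : StochasticGame S A) (Goal : Set S) {c d : ℝ} (hc : 0 ≤ c) (hd : 0 ≤ d)
    {f g : S → ℝ} (h : ∀ t, f t ≤ g t + d) (s : S) :
    G.bellman Goal c f s ≤ G.bellman Goal c g s + c * d := by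
  unfold bellman
  split_ifs
  · have := mul_nonneg hc hd
    linarith
  · rw [← mul_add]
    exact mul_le_mul_of_nonneg_left
      (G.opt_le_opt_add s fun a _ => G.actionMean_le_add h s a) hc

lemma dist_bellman_le (G : StochasticGame S A) (Goal : Set S) {c : ℝ} (hc : 0 ≤ c)
    (f g : S → ℝ) : dist (G.bellman Goal c f) (G.bellman Goal c g) ≤ c * dist f g := by
  have key : ∀ f g : S → ℝ, ∀ t, f t ≤ g t + dist f g := fun f g t => by
    have := (le_abs_self _).trans (dist_le_pi_dist f g t)
    linarith
  refine (dist_pi_le_iff (by positivity)).2 fun s => ?_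
  rw [Real.dist_eq, abs_sub_le_iff]
  have h1 := G.bellman_le_add Goal hc dist_nonneg (key f g) s
  have h2 := G.bellman_le_add Goal hc dist_nonneg (key g f) s
  rw [dist_comm g f] at h2
  constructor <;> linarith

/-- Existence is Banach's fixed point theorem; non-negativity follows from the equation at a point
where the fixed point is minimal. -/
lemma exists_bellman_fixedPoint (G : StochasticGame S A) (Goal : Set S) {c : ℝ} (hc : 0 ≤ c)
    (hc1 : c < 1) : ∃ v : S → ℝ, G.bellman Goal c v = v ∧ ∀ s, 0 ≤ v s := by
  have hcon : ContractingWith ⟨c, hc⟩ (G.bellman Goal c) :=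
    ⟨by exact_mod_cast hc1, LipschitzWith.of_dist_le_mul fun f g => G.dist_bellman_le Goal hc f g⟩
  have hv := hcon.fixedPoint_isFixedPt
  set v := ContractingWith.fixedPoint (G.bellman Goal c) hcon with hvdef
  refine ⟨v, hv, fun s => ?_⟩
  obtain ⟨m, -, hm⟩ := Finset.exists_min_image Finset.univ v ⟨s, Finset.mem_univ s⟩
  refine le_trans ?_ (hm s (Finset.mem_univ s))
  have hvm : G.bellman Goal c v m = v m := congrFun hv m
  unfold bellman at hvm
  split_ifs at hvm
  · linarith
  · obtain ⟨a, -, ha⟩ := G.exists_opt_eq m (G.actionMean v m)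
    have h1 : v m ≤ G.opt m (G.actionMean v m) := by
      have := G.actionMean_le_add (f := fun _ => v m) (g := v) (c := 0)
        (fun t => by simpa using hm t (Finset.mem_univ t)) m a
      rw [actionMean_const] at this
      linarith
    nlinarith [mul_le_mul_of_nonneg_left h1 hc]

end Bellman

/-! ### Optimal memoryless strategies -/

/-- The deterministic strategy that plays the action `d s` in every state `s` of player `p`. -/
noncomputable def pureStrategy (G : StochasticGame S A) (p : Player) (d : S → A)
    (hd : ∀ s, d s ∈ G.Av s) : G.Strategy p :=
  ⟨fun s => PMF.pure (d s), fun s a ha => by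
    rw [PMF.support_pure, Set.mem_singleton_iff] at ha
    exact ha ▸ hd s⟩

instance (G : StochasticGame S A) (p : Player) : Nonempty (G.Strategy p) :=
  ⟨G.pureStrategy p (fun s => (G.Av_nonempty s).choose) fun s => (G.Av_nonempty s).choose_spec⟩

lemma mem_Av_of_choice_ne_zero (G : StochasticGame S A) (σ : G.Strategy .maximizer)
    (τ : G.Strategy .minimizer) {s : S} {a : A} (h : G.choice σ τ s a ≠ 0) : a ∈ G.Av s := by
  unfold choice at h
  split at h
  · exact σ.2 _ a ((PMF.mem_support_iff _ _).2 h)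
  · exact τ.2 _ a ((PMF.mem_support_iff _ _).2 h)

lemma choice_of_maximizer (G : StochasticGame S A) {d : S → A} (hd : ∀ s, d s ∈ G.Av s)
    (τ : G.Strategy .minimizer) {s : S} (hs : G.player s = .maximizer) :
    G.choice (G.pureStrategy _ d hd) τ s = PMF.pure (d s) := by
  unfold choice
  split
  · rfl
  · simp_all

lemma choice_of_minimizer (G : StochasticGame S A) {d : S → A} (hd : ∀ s, d s ∈ G.Av s)
    (σ : G.Strategy .maximizer) {s : S} (hs : G.player s = .minimizer) :
    G.choice σ (G.pureStrategy _ d hd) s = PMF.pure (d s) := by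
  unfold choice
  split
  · simp_all
  · rfl

section StepMean

variable [Fintype S]

lemma stepMean_mono (G : StochasticGame S A) (σ : G.Strategy .maximizer)
    (τ : G.Strategy .minimizer) {f g : S → ℝ} (h : ∀ t, f t ≤ g t) (s : S) :
    G.stepMean σ τ f s ≤ G.stepMean σ τ g s :=
  Finset.sum_le_sum fun t _ => mul_le_mul_of_nonneg_left (h t) ENNReal.toReal_nonneg

variable [Fintype A]

lemma stepMean_eq (G : StochasticGame S A) (σ : G.Strategy .maximizer)
    (τ : G.Strategy .minimizer) (f : S → ℝ) (s : S) :
    G.stepMean σ τ f s = ∑ a, (G.choice σ τ s a).toReal * G.actionMean f s a := by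
  have : ∀ u, (G.step σ τ s u).toReal = ∑ a, (G.choice σ τ s a).toReal * G.prob s a u := by
    intro u
    rw [step, PMF.bind_apply, tsum_fintype, ENNReal.toReal_sum]
    · simp [ENNReal.toReal_mul, prob]
    · exact fun a _ => ENNReal.mul_ne_top (PMF.apply_ne_top _ _) (PMF.apply_ne_top _ _)
  simp only [stepMean, this, actionMean, Finset.sum_mul, Finset.mul_sum, mul_assoc]
  exact Finset.sum_comm

lemma le_stepMean (G : StochasticGame S A) (σ : G.Strategy .maximizer)
    (τ : G.Strategy .minimizer) {f : S → ℝ} {s : S} {c : ℝ}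
    (h : ∀ a, G.choice σ τ s a ≠ 0 → c ≤ G.actionMean f s a) : c ≤ G.stepMean σ τ f s := by
  rw [stepMean_eq, ← one_mul c, ← sum_toReal_eq_one (G.choice σ τ s), Finset.sum_mul]
  refine Finset.sum_le_sum fun a _ => ?_
  by_cases h0 : G.choice σ τ s a = 0
  · simp [h0]
  · exact mul_le_mul_of_nonneg_left (h a h0) ENNReal.toReal_nonneg

lemma stepMean_le (G : StochasticGame S A) (σ : G.Strategy .maximizer)
    (τ : G.Strategy .minimizer) {f : S → ℝ} {s : S} {c : ℝ}
    (h : ∀ a, G.choice σ τ s a ≠ 0 → G.actionMean f s a ≤ c) : G.stepMean σ τ f s ≤ c := by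
  rw [stepMean_eq, ← one_mul c, ← sum_toReal_eq_one (G.choice σ τ s), Finset.sum_mul]
  refine Finset.sum_le_sum fun a _ => ?_
  by_cases h0 : G.choice σ τ s a = 0
  · simp [h0]
  · exact mul_le_mul_of_nonneg_left (h a h0) ENNReal.toReal_nonneg

/-- Maximizer's greedy strategy with respect to `f`. In Minimizer's states the inequality holds for
every available action. -/
lemma exists_maximizer_opt_le_stepMean (G : StochasticGame S A) (f : S → ℝ) :
    ∃ σ : G.Strategy .maximizer, ∀ (τ : G.Strategy .minimizer) s,
      G.opt s (G.actionMean f s) ≤ G.stepMean σ τ f s := by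
  choose d hd hopt using fun s => G.exists_opt_eq s (G.actionMean f s)
  refine ⟨G.pureStrategy _ d hd, fun τ s => G.le_stepMean _ _ fun a ha => ?_⟩
  cases hs : G.player s with
  | maximizer =>
    rw [choice_of_maximizer G hd τ hs, PMF.pure_apply] at ha
    obtain rfl : a = d s := by
      by_contra h
      simp [h] at ha
    exact (hopt s).le
  | minimizer => exact G.opt_le_of_minimizer hs _ (G.mem_Av_of_choice_ne_zero _ _ ha)

/-- Minimizer's greedy strategy with respect to `f`. -/
lemma exists_minimizer_stepMean_le_opt (G : StochasticGame S A) (f : S → ℝ) :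
    ∃ τ : G.Strategy .minimizer, ∀ (σ : G.Strategy .maximizer) s,
      G.stepMean σ τ f s ≤ G.opt s (G.actionMean f s) := by
  choose d hd hopt using fun s => G.exists_opt_eq s (G.actionMean f s)
  refine ⟨G.pureStrategy _ d hd, fun σ s => G.stepMean_le _ _ fun a ha => ?_⟩
  cases hs : G.player s with
  | minimizer =>
    rw [choice_of_minimizer G hd σ hs, PMF.pure_apply] at ha
    obtain rfl : a = d s := by
      by_contra h
      simp [h] at ha
    exact (hopt s).ge
  | maximizer => exact G.le_opt_of_maximizer hs _ (G.mem_Av_of_choice_ne_zero _ _ ha)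

end StepMean

/-! ### The Bellman equation for the value -/

section Value

variable [Fintype S] [MeasurableSpace S] [DiscreteMeasurableSpace S]

lemma reachProb_nonneg (G : StochasticGame S A) (Goal : Set S) (σ : G.Strategy .maximizer)
    (τ : G.Strategy .minimizer) (s : S) : 0 ≤ G.reachProb Goal σ τ s :=
  measureReal_nonneg

lemma reachProb_le_one (G : StochasticGame S A) (Goal : Set S) (σ : G.Strategy .maximizer)
    (τ : G.Strategy .minimizer) (s : S) : G.reachProb Goal σ τ s ≤ 1 :=
  measureReal_le_one

lemma bddBelow_reachProb (G : StochasticGame S A) (Goal : Set S) (σ : G.Strategy .maximizer)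
    (s : S) : BddBelow (Set.range fun τ => G.reachProb Goal σ τ s) :=
  ⟨0, by rintro _ ⟨τ, rfl⟩; exact G.reachProb_nonneg Goal σ τ s⟩

lemma bddAbove_iInf_reachProb (G : StochasticGame S A) (Goal : Set S) (s : S) :
    BddAbove (Set.range fun σ => ⨅ τ, G.reachProb Goal σ τ s) := by
  refine ⟨1, ?_⟩
  rintro _ ⟨σ, rfl⟩
  exact (ciInf_le (G.bddBelow_reachProb Goal σ s) (Classical.arbitrary _)).trans
    (G.reachProb_le_one _ _ _ _)

lemma val_le_one (G : StochasticGame S A) (Goal : Set S) (s : S) : G.val Goal s ≤ 1 :=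
  ciSup_le fun σ => (ciInf_le (G.bddBelow_reachProb Goal σ s) (Classical.arbitrary _)).trans
    (G.reachProb_le_one _ _ _ _)

lemma val_nonneg (G : StochasticGame S A) (Goal : Set S) (s : S) : 0 ≤ G.val Goal s :=
  Real.iSup_nonneg fun σ => Real.iInf_nonneg fun τ => G.reachProb_nonneg Goal σ τ s

/-- A non-negative supermartingale bound: a function that is at least `1` on `Goal` and does not
increase in mean outside of `Goal` dominates the reachability probability. -/
lemma reachProb_le_of_stepMean_le (G : StochasticGame S A) (Goal : Set S)
    (σ : G.Strategy .maximizer) (τ : G.Strategy .minimizer) {v : S → ℝ} (h0 : ∀ s, 0 ≤ v s)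
    (h1 : ∀ s ∈ Goal, 1 ≤ v s) (h : ∀ s, s ∉ Goal → G.stepMean σ τ v s ≤ v s) (s : S) :
    G.reachProb Goal σ τ s ≤ v s := by
  have key : ∀ n s, G.reachWithin Goal σ τ n s ≤ v s := by
    intro n
    induction n with
    | zero =>
      intro s
      by_cases hs : s ∈ Goal
      · rw [G.reachWithin_of_mem σ τ _ hs]; exact h1 s hs
      · rw [G.reachWithin_zero Goal σ τ hs]; exact h0 s
    | succ n ih =>
      intro s
      by_cases hs : s ∈ Goal
      · rw [G.reachWithin_of_mem σ τ _ hs]; exact h1 s hs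
      · rw [G.reachWithin_succ Goal σ τ n hs]
        exact (G.stepMean_mono σ τ ih s).trans (h s hs)
  exact le_of_tendsto' (G.tendsto_reachWithin Goal σ τ s) fun n => key n s

/-- A discounted submartingale bound. The discount `c < 1` is what rules out functions that are
preserved in mean without any progress towards `Goal`: at a maximum point of `v - reachProb`
the inequality forces this difference to be non-positive. -/
lemma le_reachProb_of_le_stepMean (G : StochasticGame S A) (Goal : Set S)
    (σ : G.Strategy .maximizer) (τ : G.Strategy .minimizer) {v : S → ℝ} {c : ℝ} (hc : 0 ≤ c)
    (hc1 : c < 1) (h1 : ∀ s ∈ Goal, v s ≤ 1)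
    (h : ∀ s, s ∉ Goal → v s ≤ c * G.stepMean σ τ v s) (s : S) :
    v s ≤ G.reachProb Goal σ τ s := by
  set r := G.reachProb Goal σ τ
  obtain ⟨m, -, hm⟩ := Finset.exists_max_image Finset.univ (fun s => v s - r s)
    ⟨s, Finset.mem_univ s⟩
  suffices hle : v m - r m ≤ 0 by
    have := hm s (Finset.mem_univ s)
    linarith
  by_cases hmG : m ∈ Goal
  · have := h1 m hmG
    have hr : r m = 1 := G.reachProb_of_mem σ τ hmG
    linarith
  · have hr : r m = G.stepMean σ τ r m := G.reachProb_eq_stepMean Goal σ τ hmG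
    have hv := h m hmG
    have hr0 : 0 ≤ r m := G.reachProb_nonneg Goal σ τ m
    have hsub : G.stepMean σ τ v m ≤ G.stepMean σ τ r m + (v m - r m) := by
      calc G.stepMean σ τ v m ≤ ∑ u, (G.step σ τ m u).toReal * (r u + (v m - r m)) := by
            refine Finset.sum_le_sum fun u _ => mul_le_mul_of_nonneg_left ?_ ENNReal.toReal_nonneg
            have := hm u (Finset.mem_univ u)
            linarith
        _ = _ := by
            simp only [mul_add, Finset.sum_add_distrib, ← Finset.sum_mul, sum_toReal_eq_one,
              one_mul]
            rfl
    rw [← hr] at hsub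
    nlinarith [mul_le_mul_of_nonneg_left hsub hc, mul_nonneg (sub_nonneg.2 hc1.le) hr0]

variable [Fintype A]

lemma val_le_of_bellman_le (G : StochasticGame S A) (Goal : Set S) {v : S → ℝ}
    (h0 : ∀ s, 0 ≤ v s) (h : ∀ s, G.bellman Goal 1 v s ≤ v s) (s : S) : G.val Goal s ≤ v s := by
  obtain ⟨τ, hτ⟩ := G.exists_minimizer_stepMean_le_opt v
  refine ciSup_le fun σ => (ciInf_le (G.bddBelow_reachProb Goal σ s) τ).trans ?_
  refine G.reachProb_le_of_stepMean_le Goal σ τ h0 (fun s hs => ?_) (fun s hs => ?_) s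
  · simpa [bellman, hs] using h s
  · exact (hτ σ s).trans (by simpa [bellman, hs] using h s)

lemma le_val_of_le_bellman (G : StochasticGame S A) (Goal : Set S) {v : S → ℝ} {c : ℝ}
    (hc : 0 ≤ c) (hc1 : c < 1) (h : ∀ s, v s ≤ G.bellman Goal c v s) (s : S) :
    v s ≤ G.val Goal s := by
  obtain ⟨σ, hσ⟩ := G.exists_maximizer_opt_le_stepMean v
  refine le_trans (le_ciInf fun τ => ?_) (le_ciSup (G.bddAbove_iInf_reachProb Goal s) σ)
  refine G.le_reachProb_of_le_stepMean Goal σ τ hc hc1 (fun s hs => ?_) (fun s hs => ?_) s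
  · simpa [bellman, hs] using h s
  · refine le_trans (by simpa [bellman, hs] using h s)
      (mul_le_mul_of_nonneg_left (hσ τ s) hc)

/-- The value satisfies the Bellman equation: a limit point `v`, as `c → 1`, of fixed points of
the discounted operators is a fixed point of the undiscounted one, and `v ≤ val ≤ v`. -/
theorem bellman_val (G : StochasticGame S A) (Goal : Set S) :
    G.bellman Goal 1 (G.val Goal) = G.val Goal := by
  -- The discounts `1 - 1 / (n + 1)` lie in `[0, 1)` and tend to `1`.
  have hc0 : ∀ n : ℕ, (0 : ℝ) ≤ 1 - 1 / ((n : ℝ) + 1) := fun n =>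
    sub_nonneg.2 ((div_le_one (by positivity)).2 (by linarith [n.cast_nonneg (α := ℝ)]))
  have hc1 : ∀ n : ℕ, 1 - 1 / ((n : ℝ) + 1) < 1 := fun n => sub_lt_self _ (by positivity)
  choose v hv hv0 using fun n : ℕ => G.exists_bellman_fixedPoint Goal (hc0 n) (hc1 n)
  have hval : ∀ n s, v n s ≤ G.val Goal s := fun n =>
    G.le_val_of_le_bellman Goal (hc0 n) (hc1 n) fun s => (congrFun (hv n) s).ge
  obtain ⟨w, hw, φ, hφ, hlim⟩ := (isCompact_Icc (a := (0 : S → ℝ)) (b := G.val Goal)).tendsto_subseq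
    (x := v) fun n => ⟨fun s => hv0 n s, fun s => hval n s⟩
  have hfix : G.bellman Goal 1 w = w := by
    have hcont : Continuous (G.bellman Goal 1) := by
      refine LipschitzWith.continuous (K := 1) (LipschitzWith.of_dist_le_mul fun f g => ?_)
      exact_mod_cast G.dist_bellman_le Goal zero_le_one f g
    have hT := (hcont.tendsto w).comp hlim
    ext s
    refine tendsto_nhds_unique ?_ (tendsto_pi_nhds.1 hlim s)
    by_cases hs : s ∈ Goal
    · have : ∀ n, v n s = 1 := fun n => by
        rw [← hv n]; simp [bellman, hs]
      simp [bellman, hs, this]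
    · have hc : Filter.Tendsto (fun n => 1 - 1 / ((φ n : ℝ) + 1)) Filter.atTop (nhds 1) := by
        simpa using (tendsto_one_div_add_atTop_nhds_zero_nat (𝕜 := ℝ)).comp
          hφ.tendsto_atTop |>.const_sub 1
      have := hc.mul (tendsto_pi_nhds.1 hT s)
      rw [one_mul] at this
      refine this.congr fun n => ?_
      conv_rhs => rw [Function.comp_apply, ← hv (φ n)]
      simp [bellman, hs]
  have : G.val Goal = w := le_antisymm
    (G.val_le_of_bellman_le Goal (fun s => hw.1 s) fun s => (congrFun hfix s).le) hw.2
  rw [this, hfix]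

end Value

/-! ### Soundness of the updates -/

section Estimates

variable [Fintype S]

lemma lowerEst_nonneg (count : S → A → S → ℕ) (δT : ℝ) (s : S) (a : A) (t : S) :
    0 ≤ lowerEst count δT s a t :=
  le_max_left _ _

lemma lbHat_le_actionMean (G : StochasticGame S A) (count : S → A → S → ℕ) (δT : ℝ) {s : S} {a : A}
    (hest : ∀ t, lowerEst count δT s a t ≤ G.prob s a t) {f v : S → ℝ} (hv0 : ∀ t, 0 ≤ v t)
    (hf : ∀ t, f t ≤ v t) : lbHat count δT f s a ≤ G.actionMean v s a := by
  calc lbHat count δT f s a ≤ ∑ t with 0 < count s a t, G.prob s a t * v t :=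
        Finset.sum_le_sum fun t _ =>
          (mul_le_mul_of_nonneg_left (hf t) (lowerEst_nonneg count δT s a t)).trans
            (mul_le_mul_of_nonneg_right (hest t) (hv0 t))
    _ ≤ _ := Finset.sum_le_univ_sum_of_nonneg fun t => mul_nonneg (G.prob_nonneg s a t) (hv0 t)

/-- In terms of the deficits `1 - v`, the upper estimate is an instance of the lower one:
`1 - ubHat f = lbHat (1 - f)`. -/
lemma actionMean_le_ubHat (G : StochasticGame S A) (count : S → A → S → ℕ) (δT : ℝ) {s : S} {a : A}
    (hest : ∀ t, lowerEst count δT s a t ≤ G.prob s a t) {f v : S → ℝ} (hv1 : ∀ t, v t ≤ 1)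
    (hf : ∀ t, v t ≤ f t) : G.actionMean v s a ≤ ubHat count δT f s a := by
  have h := G.lbHat_le_actionMean count δT hest (f := fun t => 1 - f t) (v := fun t => 1 - v t)
    (fun t => sub_nonneg.2 (hv1 t)) fun t => sub_le_sub_left (hf t) 1
  simp only [lbHat, actionMean, mul_sub, mul_one, Finset.sum_sub_distrib, sum_prob] at h
  simp only [ubHat, actionMean]
  linarith

end Estimates

/-- A property `R` of all entries survives a simultaneous update if it survives the update of each
single entry outside of `Goal`. -/
lemma updateSim_induction (G : StochasticGame S A) (Goal : Set S) (fhat : (S → ℝ) → S → A → ℝ)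
    (R : S → ℝ → Prop)
    (hR : ∀ f : S → ℝ, (∀ s, R s (f s)) → ∀ s, s ∉ Goal → R s (G.opt s (fhat f s)))
    (X : Set S) {f : S → ℝ} (hf : ∀ s, R s (f s)) (s : S) :
    R s (G.updateSim Goal fhat X f s) := by
  unfold updateSim
  split_ifs with hs
  · exact hR f hf s hs.2
  · exact hf s

/-- The in-place version of `updateSim_induction`; the list may visit states repeatedly. -/
lemma updateSeq_induction (G : StochasticGame S A) (Goal : Set S) (fhat : (S → ℝ) → S → A → ℝ)
    (R : S → ℝ → Prop)
    (hR : ∀ f : S → ℝ, (∀ s, R s (f s)) → ∀ s, s ∉ Goal → R s (G.opt s (fhat f s)))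
    (l : List S) (hl : ∀ s ∈ l, s ∉ Goal) {f : S → ℝ} (hf : ∀ s, R s (f s)) (s : S) :
    R s (G.updateSeq fhat l f s) := by
  classical
  induction l generalizing f with
  | nil => exact hf s
  | cons u l ih =>
    refine ih (fun s hs => hl s (List.mem_cons_of_mem _ hs))
      (f := Function.update f u (G.opt u (fhat f u))) fun t => ?_
    by_cases ht : t = u
    · subst ht
      rw [Function.update_self]
      exact hR f hf t (hl t List.mem_cons_self)
    · rw [Function.update_of_ne ht]
      exact hf t

section Value

variable [Fintype S] [Fintype A] [MeasurableSpace S] [DiscreteMeasurableSpace S]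

lemma val_eq_opt (G : StochasticGame S A) {Goal : Set S} {s : S} (hs : s ∉ Goal) :
    G.val Goal s = G.opt s (G.actionMean (G.val Goal) s) := by
  simpa [bellman, hs] using (congrFun (G.bellman_val Goal) s).symm

lemma opt_lbHat_le_val (G : StochasticGame S A) (Goal : Set S) (count : S → A → S → ℕ) (δT : ℝ)
    (hest : ∀ s, ∀ a ∈ G.Av s, ∀ t, lowerEst count δT s a t ≤ G.prob s a t) (f : S → ℝ)
    (hf : ∀ s, f s ≤ G.val Goal s) (s : S) (hs : s ∉ Goal) :
    G.opt s (lbHat count δT f s) ≤ G.val Goal s := by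
  rw [G.val_eq_opt hs]
  exact G.opt_mono s fun a ha =>
    G.lbHat_le_actionMean count δT (hest s a ha) (G.val_nonneg Goal) hf

lemma val_le_opt_ubHat (G : StochasticGame S A) (Goal : Set S) (count : S → A → S → ℕ) (δT : ℝ)
    (hest : ∀ s, ∀ a ∈ G.Av s, ∀ t, lowerEst count δT s a t ≤ G.prob s a t) (f : S → ℝ)
    (hf : ∀ s, G.val Goal s ≤ f s) (s : S) (hs : s ∉ Goal) :
    G.val Goal s ≤ G.opt s (ubHat count δT f s) := by
  rw [G.val_eq_opt hs]
  exact G.opt_mono s fun a ha =>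
    G.actionMean_le_ubHat count δT (hest s a ha) (G.val_le_one Goal) hf

end Value

end StochasticGame

theorem lemma1 {S A : Type*} [Fintype S] [Fintype A] [MeasurableSpace S]
    [DiscreteMeasurableSpace S] (G : StochasticGame S A) (Goal X : Set S)
    (count : S → A → S → ℕ) (δT : ℝ) (hδT : 0 < δT) (hδT1 : δT ≤ 1)
    (hest : ∀ s, ∀ a ∈ G.Av s, ∀ t, lowerEst count δT s a t ≤ G.prob s a t)
    (lb ub : S → ℝ) (hlb : ∀ s, lb s ≤ G.val Goal s) (hub : ∀ s, G.val Goal s ≤ ub s) :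
    (∀ s, G.updateSim Goal (lbHat count δT) X lb s ≤ G.val Goal s ∧
      G.val Goal s ≤ G.updateSim Goal (ubHat count δT) X ub s) ∧
    (∀ l₁ l₂ : List S,
      (l₁.Nodup ∧ ∀ s, s ∈ l₁ ↔ s ∈ X \ Goal) →
      (l₂.Nodup ∧ ∀ s, s ∈ l₂ ↔ s ∈ X \ Goal) →
      ∀ s, G.updateSeq (lbHat count δT) l₁ lb s ≤ G.val Goal s ∧
        G.val Goal s ≤ G.updateSeq (ubHat count δT) l₂ ub s) := by
  have hL := G.opt_lbHat_le_val Goal count δT hest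
  have hU := G.val_le_opt_ubHat Goal count δT hest
  refine ⟨fun s => ⟨?_, ?_⟩, fun l₁ l₂ h₁ h₂ s => ⟨?_, ?_⟩⟩
  · exact G.updateSim_induction Goal _ (fun s x => x ≤ G.val Goal s) hL X hlb s
  · exact G.updateSim_induction Goal _ (fun s x => G.val Goal s ≤ x) hU X hub s
  · exact G.updateSeq_induction Goal _ (fun s x => x ≤ G.val Goal s) hL l₁
      (fun s hs => ((h₁.2 s).1 hs).2) hlb s
  · exact G.updateSeq_induction Goal _ (fun s x => G.val Goal s ≤ x) hU l₂
      (fun s hs => ((h₂.2 s).1 hs).2) hub s
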